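/- Let $N=N(n)>n$ be integers, put $r=N/n$, let $\omega=\omega(n)\ge 2$ be real numbers (for instance $\omega=\omega(r)$ a function of $r$), and let $p=\frac{1}{\omega n}$. Assume that $p\ge 1/N$ (that is, $\omega\le r$) and that $4\log N\le n$ for all sufficiently large $n$. Let $G(N,p)$ be the binomial random graph on $N$ vertices with edge probability $p$, let $P_{n+1}$ be the path with $n+1$ vertices, and for graphs $G,F$ let $c(G,F)$ be the minimum number $k$ such that the edges of $G$ can be colored with $k$ colors without a monochromatic copy of $F$. Then $$\lim_{n\to\infty}\Pr\left[c(G(N,p),P_{n+1})\le \frac{2r}{\omega}\right]=1 .$$ -/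

import Mathlib

/-- `c(G, F)`: the minimum number `k` of colors such that the edges of `G` can be colored with `k`
colors without a monochromatic copy of `F` (no color class contains `F` as a subgraph, not
necessarily induced); it is `⊤` if no finite number of colors suffices. -/
noncomputable def SimpleGraph.avoidingColorNumber {V W : Type*}
    (G : SimpleGraph V) (F : SimpleGraph W) : ℕ∞ :=
  ⨅ k ∈ {k : ℕ | ∃ C : G.EdgeLabeling (Fin k), ∀ i, F.Free (C.labelGraph i)}, (k : ℕ∞)

/-!
Write `d = N p ≥ 1` and use `k = ⌊2 d⌋` colors. A copy of a graph `F` with `e` edges is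
monochromatic under a uniformly random coloring with probability `k / k ^ e`, so a graph with fewer
than `k ^ e / k` labelled copies of `F` has a coloring without a monochromatic one. The expected
number of labelled copies in `G(N, p)` is at most `N ^ v p ^ e`, where `v` is the number of vertices
of `F`, so by Markov's inequality no such coloring exists with probability at most
`k N ^ v (p / k) ^ e`. If `F` is connected on `v = n + 1` vertices, then `e ≥ n` and this is at most
`k N (d / k) ^ n`.

Since `2 d < k + 1`, the ratio `d / k` is below `(k + 1) / (2 k)`: this is at most `3 / 4` for
`k ≥ 2`, and at most `9 / 16 = (3 / 4) ^ 2` for `k ≥ 8`, which compensates for the factor `k ≤ 2 N`.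
Hence the failure probability is at most `8 N (3 / 4) ^ n`, which tends to `0` when `4 log N ≤ n`
because `exp (1 / 4) < 4 / 3`.
-/

open MeasureTheory ProbabilityTheory SimpleGraph unitInterval Filter
open scoped ENNReal Topology

section Coloring

variable {E K V W : Type*}

lemma card_piFinset_ite_singleton_univ [Fintype E] [DecidableEq E] [Fintype K] (s : Finset E)
    (c : K) :
    (Fintype.piFinset fun e => if e ∈ s then {c} else Finset.univ).card =
      Fintype.card K ^ sᶜ.card := by
  simp [Fintype.card_piFinset, apply_ite, Finset.prod_ite, Finset.filter_not,
    Finset.compl_eq_univ_sdiff]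

lemma exists_coloring_forall_not_monochromatic {ι : Type*} [Fintype ι] [Finite E] [Fintype K]
    [Nonempty K] (s : ι → Finset E) {m : ℕ} (hs : ∀ i, (s i).card = m)
    (h : Fintype.card ι * Fintype.card K < Fintype.card K ^ m) :
    ∃ C : E → K, ∀ i c, ∃ e ∈ s i, C e ≠ c := by
  classical
  cases nonempty_fintype E
  by_contra! hmono
  let mono (x : ι × K) : Finset (E → K) :=
    Fintype.piFinset fun e => if e ∈ s x.1 then {x.2} else Finset.univ
  have hcover : Finset.univ ⊆ Finset.univ.biUnion mono := fun C _ => by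
    obtain ⟨i, c, hC⟩ := hmono C
    refine Finset.mem_biUnion.2 ⟨(i, c), Finset.mem_univ _, Fintype.mem_piFinset.2 fun e => ?_⟩
    split_ifs with he
    · exact Finset.mem_singleton.2 (hC e he)
    · exact Finset.mem_univ _
  have hmono_card (x : ι × K) :
      (mono x).card * Fintype.card K ^ m = Fintype.card K ^ Fintype.card E := by
    rw [card_piFinset_ite_singleton_univ, ← hs x.1, ← pow_add, add_comm, Finset.card_add_card_compl]
  have hle : Fintype.card K ^ Fintype.card E * Fintype.card K ^ m ≤
      Fintype.card K ^ Fintype.card E * (Fintype.card ι * Fintype.card K) :=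
    calc Fintype.card K ^ Fintype.card E * Fintype.card K ^ m
        ≤ (∑ x, (mono x).card) * Fintype.card K ^ m := by
          gcongr
          rw [← Fintype.card_fun, ← Finset.card_univ]
          exact (Finset.card_le_card hcover).trans Finset.card_biUnion_le
      _ = Fintype.card K ^ Fintype.card E * (Fintype.card ι * Fintype.card K) := by
          simp only [Finset.sum_mul, hmono_card, Finset.sum_const, Finset.card_univ,
            Fintype.card_prod, smul_eq_mul]
          ring
  exact h.not_ge (Nat.le_of_mul_le_mul_left hle (pow_pos Fintype.card_pos _))

lemma exists_copy_forall_eq_of_isContained_labelGraph {G : SimpleGraph V} {F : SimpleGraph W}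
    (C : G.EdgeLabeling K) {c : K} (h : F ⊑ C.labelGraph c) :
    ∃ f : Copy F G, ∀ e, C (f.mapEdgeSet e) = c := by
  obtain ⟨g⟩ := h
  refine ⟨(Copy.ofLE _ _ C.labelGraph_le).comp g, ?_⟩
  rintro ⟨⟨a, b⟩, hab⟩
  exact ((C.labelGraph_adj _ _).1 (g.toHom.map_adj hab)).2

lemma exists_edgeLabeling_forall_free [Fintype V] [Fintype W] [Fintype K] [Nonempty K]
    (G : SimpleGraph V) (F : SimpleGraph W)
    (h : G.labelledCopyCount F * Fintype.card K < Fintype.card K ^ F.edgeSet.ncard) :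
    ∃ C : G.EdgeLabeling K, ∀ c, F.Free (C.labelGraph c) := by
  classical
  have hcard (f : Copy F G) : (Finset.univ.map f.mapEdgeSet).card = F.edgeSet.ncard := by
    rw [Finset.card_map, Finset.card_univ, ← Nat.card_eq_fintype_card, Nat.card_coe_set_eq]
  obtain ⟨C, hC⟩ := exists_coloring_forall_not_monochromatic _ hcard
    (by simpa only [labelledCopyCount, Fintype.card_eq_nat_card] using h)
  refine ⟨C, fun c hc => ?_⟩
  obtain ⟨f, hf⟩ := exists_copy_forall_eq_of_isContained_labelGraph C hc
  obtain ⟨_, he, hne⟩ := hC f c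
  obtain ⟨e, -, rfl⟩ := Finset.mem_map.1 he
  exact hne (hf e)

lemma avoidingColorNumber_le_of_labelledCopyCount_lt [Fintype V] [Fintype W] {G : SimpleGraph V}
    {F : SimpleGraph W} {k : ℕ} (hk : 0 < k)
    (h : G.labelledCopyCount F * k < k ^ F.edgeSet.ncard) : G.avoidingColorNumber F ≤ k := by
  have : Nonempty (Fin k) := ⟨⟨0, hk⟩⟩
  exact iInf₂_le k (exists_edgeLabeling_forall_free G F (by simpa using h))

end Coloring

section FirstMoment

variable {V W : Type*}

lemma setBernoulli_setOf_subset {ι : Type*} {u : Set ι} (p : I) {s : Set ι} (hs : s.Finite)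
    (hsu : s ⊆ u) : setBernoulli u p {t | s ⊆ t} = (toNNReal p : ℝ≥0∞) ^ s.ncard := by
  lift s to Finset ι using hs
  have hpi : (fun q : ι → Prop => {i | q i}) ⁻¹' {t | (s : Set ι) ⊆ t} =
      Set.pi (s : Set ι) fun _ => {True} := by
    ext q
    simp [Set.subset_def]
  rw [setBernoulli_apply', hpi, Measure.infinitePi_pi _ fun _ _ => .of_discrete,
    Finset.prod_congr rfl (g := fun _ => (toNNReal p : ℝ≥0∞)) fun i hi => by simp [hsu hi],
    Finset.prod_const, Set.ncard_coe_finset]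

instance [Finite V] : DiscreteMeasurableSpace (SimpleGraph V) where
  forall_measurableSet _ := measurableEmbedding_edgeSet.measurableSet_image.1 .of_discrete

lemma binomialRandom_real_setOf_le [Finite V] (p : I) (H : SimpleGraph V) :
    (binomialRandom V p).real {G | H ≤ G} = (p : ℝ) ^ H.edgeSet.ncard := by
  have hpre : fromEdgeSet ⁻¹' {G | H ≤ G} = {S : Set (Sym2 V) | H.edgeSet ⊆ S} := by
    ext S
    simp
  rw [measureReal_def, binomialRandom_eq_map,
    Measure.map_apply measurable_fromEdgeSet .of_discrete, hpre,
    setBernoulli_setOf_subset p H.edgeSet.toFinite H.edgeSet_subset_compl_diagSet]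
  simp

lemma labelledCopyCount_eq_card_embedding [Fintype V] [Fintype W] (G : SimpleGraph V)
    (F : SimpleGraph W) : G.labelledCopyCount F = Nat.card {f : W ↪ V // F.map f ≤ G} := by
  classical
  rw [labelledCopyCount, ← Nat.card_eq_fintype_card]
  exact Nat.card_congr
    { toFun f := ⟨f.toEmbedding, (map_le_iff_le_comap _ _ _).2 f.toHom.le_comap⟩
      invFun f := ⟨⟨f.1, fun h => (map_le_iff_le_comap _ _ _).1 f.2 h⟩, f.1.injective⟩
      left_inv _ := rfl
      right_inv _ := rfl }

lemma integral_labelledCopyCount [Fintype V] [Fintype W] (p : I) (F : SimpleGraph W) :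
    ∫ G, (G.labelledCopyCount F : ℝ) ∂binomialRandom V p =
      (Fintype.card V).descFactorial (Fintype.card W) * (p : ℝ) ^ F.edgeSet.ncard := by
  classical
  have hsum (G : SimpleGraph V) : (G.labelledCopyCount F : ℝ) =
      ∑ f : W ↪ V, {G : SimpleGraph V | F.map f ≤ G}.indicator 1 G := by
    simp [labelledCopyCount_eq_card_embedding, Fintype.card_subtype, Set.indicator_apply]
  have hedges (f : W ↪ V) : (F.map f).edgeSet.ncard = F.edgeSet.ncard := by
    rw [edgeSet_map, Set.ncard_image_of_injective _ f.sym2Map.injective]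
  simp_rw [hsum]
  rw [integral_finsetSum _ fun _ _ => .of_finite]
  simp_rw [integral_indicator_one MeasurableSet.of_discrete]
  simp [ binomialRandom_real_setOf_le, hedges, Fintype.card_embedding_eq]

lemma binomialRandom_real_lt_avoidingColorNumber_le [Fintype V] [Fintype W] (p : I)
    (F : SimpleGraph W) {k : ℕ} (hk : 0 < k) :
    (binomialRandom V p).real {G | k < G.avoidingColorNumber F} ≤
      k * (Fintype.card V : ℝ) ^ Fintype.card W * (p / k) ^ F.edgeSet.ncard := by
  have hmany : {G : SimpleGraph V | k < G.avoidingColorNumber F} ⊆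
      {G | (k : ℝ) ^ F.edgeSet.ncard ≤ G.labelledCopyCount F * k} := fun G hG => by
    by_contra hfew
    rw [Set.mem_ofPred_eq, not_le] at hfew
    exact (avoidingColorNumber_le_of_labelledCopyCount_lt hk (by exact_mod_cast hfew)).not_gt hG
  have hmarkov := mul_meas_ge_le_integral_of_nonneg (μ := binomialRandom V p)
    (f := fun G => (G.labelledCopyCount F * k : ℝ)) (.of_forall fun _ => by positivity) .of_finite
    ((k : ℝ) ^ F.edgeSet.ncard)
  rw [integral_mul_const, integral_labelledCopyCount, ← le_div_iff₀' (by positivity)] at hmarkov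
  calc (binomialRandom V p).real {G | k < G.avoidingColorNumber F}
      ≤ (Fintype.card V).descFactorial (Fintype.card W) * (p : ℝ) ^ F.edgeSet.ncard * k /
          k ^ F.edgeSet.ncard := (measureReal_mono hmany).trans hmarkov
    _ ≤ (Fintype.card V : ℝ) ^ Fintype.card W * (p : ℝ) ^ F.edgeSet.ncard * k /
          k ^ F.edgeSet.ncard := by
        have := p.2.1
        gcongr
        exact_mod_cast Nat.descFactorial_le_pow _ _
    _ = k * (Fintype.card V : ℝ) ^ Fintype.card W * (p / k) ^ F.edgeSet.ncard := by
        rw [div_pow]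
        ring

end FirstMoment

section Connected

variable {V W : Type*} [Fintype V] [Fintype W]

lemma binomialRandom_real_lt_avoidingColorNumber_le_of_connected (p : I) {F : SimpleGraph W}
    (hF : F.Connected) {n : ℕ} (hW : Fintype.card W = n + 1) {k : ℕ} (hk : 0 < k) :
    (binomialRandom V p).real {G | k < G.avoidingColorNumber F} ≤
      k * Fintype.card V * (Fintype.card V * p / k) ^ n := by
  have hedges : n ≤ F.edgeSet.ncard := by
    have := hF.card_vert_le_card_edgeSet_add_one
    rwa [Nat.card_eq_fintype_card, hW, Nat.card_coe_set_eq, Nat.add_le_add_iff_right] at this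
  have hp0 : 0 ≤ (p : ℝ) / k := div_nonneg p.2.1 k.cast_nonneg
  have hp1 : (p : ℝ) / k ≤ 1 := div_le_one_of_le₀ (p.2.2.trans (by exact_mod_cast hk)) (by simp)
  calc (binomialRandom V p).real {G | k < G.avoidingColorNumber F}
      ≤ k * (Fintype.card V : ℝ) ^ (n + 1) * (p / k) ^ F.edgeSet.ncard :=
        hW ▸ binomialRandom_real_lt_avoidingColorNumber_le p F hk
    _ ≤ k * (Fintype.card V : ℝ) ^ (n + 1) * (p / k) ^ n := by
        gcongr 1
        exact pow_le_pow_of_le_one hp0 hp1 hedges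
    _ = k * Fintype.card V * (Fintype.card V * p / k) ^ n := by
        rw [mul_div_assoc, mul_pow]
        ring

lemma floor_two_mul_mul_pow_le {N d : ℝ} {n : ℕ} (hd : 1 ≤ d) (hdN : d ≤ N)
    (hN : N * (3 / 4) ^ n ≤ 1) :
    ⌊2 * d⌋₊ * N * (d / ⌊2 * d⌋₊) ^ n ≤ 8 * (N * (3 / 4) ^ n) := by
  set k : ℕ := ⌊2 * d⌋₊
  have hk : (2 : ℝ) ≤ k := by exact_mod_cast Nat.le_floor (by push_cast; linarith)
  have hkd : (k : ℝ) ≤ 2 * d := Nat.floor_le (by linarith)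
  have hdk : 2 * d < k + 1 := Nat.lt_floor_add_one _
  have hN0 : 0 ≤ N := by linarith
  rcases le_total (k : ℝ) 8 with hk8 | hk8
  · have hratio : d / k ≤ 3 / 4 := by
      rw [div_le_iff₀ (by linarith)]
      linarith
    calc k * N * (d / k) ^ n ≤ 8 * N * (3 / 4) ^ n := by gcongr
      _ = 8 * (N * (3 / 4) ^ n) := by ring
  · have hratio : d / k ≤ (3 / 4) ^ 2 := by
      rw [div_le_iff₀ (by linarith)]
      linarith
    calc k * N * (d / k) ^ n ≤ 2 * N * N * ((3 / 4) ^ 2) ^ n := by gcongr; linarith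
      _ = 2 * (N * (3 / 4) ^ n) ^ 2 := by
          rw [pow_right_comm]
          ring
      _ ≤ 8 * (N * (3 / 4) ^ n) := by nlinarith [show 0 ≤ N * (3 / 4) ^ n by positivity]

lemma binomialRandom_real_two_mul_lt_avoidingColorNumber_le {p : I} {F : SimpleGraph W}
    (hF : F.Connected) {n : ℕ} (hW : Fintype.card W = n + 1) (hp : 1 ≤ Fintype.card V * (p : ℝ)) :
    (binomialRandom V p).real
        {G | ENNReal.ofReal (2 * (Fintype.card V * p)) < G.avoidingColorNumber F} ≤
      8 * (Fintype.card V * (3 / 4) ^ n) := by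
  rcases le_or_gt 1 ((Fintype.card V : ℝ) * (3 / 4) ^ n) with hlarge | hsmall
  · exact measureReal_le_one.trans (by linarith)
  set d : ℝ := Fintype.card V * p
  have hk : 0 < ⌊2 * d⌋₊ := Nat.floor_pos.2 (by linarith)
  have hfloor : {G : SimpleGraph V | ENNReal.ofReal (2 * d) < G.avoidingColorNumber F} ⊆
      {G | ⌊2 * d⌋₊ < G.avoidingColorNumber F} := fun G hG => by
    have hlt : ((⌊2 * d⌋₊ : ℕ∞) : ℝ≥0∞) < G.avoidingColorNumber F :=
      lt_of_le_of_lt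
        (by simpa using ENNReal.ofReal_le_ofReal (Nat.floor_le (by linarith : 0 ≤ 2 * d))) hG
    exact_mod_cast hlt
  exact (measureReal_mono hfloor).trans <|
    (binomialRandom_real_lt_avoidingColorNumber_le_of_connected p hF hW hk).trans <|
      floor_two_mul_mul_pow_le hp (mul_le_of_le_one_right (Nat.cast_nonneg _) p.2.2) hsmall.le

end Connected

lemma tendsto_mul_three_quarters_pow_of_four_mul_log_le {a : ℕ → ℝ} (ha : ∀ n, 0 ≤ a n)
    (hlog : ∀ᶠ n : ℕ in atTop, 4 * Real.log (a n) ≤ n) :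
    Tendsto (fun n => a n * (3 / 4) ^ n) atTop (𝓝 0) := by
  have hbase : Real.exp (1 / 4) * (3 / 4) < 1 := by
    have := Real.add_one_lt_exp (x := -(1 / 4)) (by norm_num)
    rw [Real.exp_neg] at this
    rw [← lt_inv_mul_iff₀ (Real.exp_pos _)]
    linarith
  refine squeeze_zero' (.of_forall fun n => mul_nonneg (ha n) (by positivity)) ?_
    (tendsto_pow_atTop_nhds_zero_of_lt_one (by positivity) hbase)
  filter_upwards [hlog] with n hn
  have hexp : a n ≤ Real.exp (1 / 4) ^ n := by
    rw [← Real.exp_nat_mul]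
    exact (Real.le_exp_log _).trans (Real.exp_le_exp.2 (by linarith))
  rw [mul_pow]
  gcongr

theorem corollary5p3_general {W : ℕ → Type*} [∀ n, Fintype (W n)] (F : ∀ n, SimpleGraph (W n))
    (hF : ∀ n, (F n).Connected) (hW : ∀ n, Fintype.card (W n) = n + 1)
    (N : ℕ → ℕ) (ω : ℕ → ℝ) (p : ℕ → unitInterval)
    (hN : ∀ᶠ n in atTop, 0 < N n)
    (hpow : Tendsto (fun n => (N n : ℝ) * (3 / 4) ^ n) atTop (𝓝 0))
    (hp : ∀ᶠ n : ℕ in atTop, (p n : ℝ) = 1 / (ω n * n))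
    (hpN : ∀ᶠ n : ℕ in atTop, 1 / (N n : ℝ) ≤ p n) :
    Tendsto
      (fun n : ℕ =>
        binomialRandom (Fin (N n)) (p n)
          {G | (G.avoidingColorNumber (F n) : ℝ≥0∞) ≤
            ENNReal.ofReal (2 * ((N n : ℝ) / n) / ω n)})
      atTop (𝓝 1) := by
  rw [← ENNReal.tendsto_toReal_iff (fun _ => measure_ne_top _ _) ENNReal.one_ne_top]
  have hlim : Tendsto (fun n => 1 - 8 * ((N n : ℝ) * (3 / 4) ^ n)) atTop (𝓝 1) := by
    simpa using (hpow.const_mul 8).const_sub 1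
  refine tendsto_of_tendsto_of_tendsto_of_le_of_le' hlim tendsto_const_nhds ?_
    (.of_forall fun _ => measureReal_le_one)
  filter_upwards [hN, hp, hpN] with n hN hp hpN
  have hd : 2 * ((N n : ℝ) / n) / ω n = 2 * (N n * p n) := by
    rw [hp]
    ring
  have hd1 : 1 ≤ N n * (p n : ℝ) := (div_le_iff₀' (by exact_mod_cast hN)).1 hpN
  have hfail := binomialRandom_real_two_mul_lt_avoidingColorNumber_le (V := Fin (N n)) (hF n)
    (hW n) (by simpa using hd1)
  rw [Fintype.card_fin, ← hd] at hfail
  simp_rw [← not_le] at hfail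
  rw [← Set.compl_ofPred, probReal_compl_eq_one_sub .of_discrete] at hfail
  exact sub_le_comm.1 hfail

theorem corollary5p3 (N : ℕ → ℕ) (ω : ℕ → ℝ) (p : ℕ → unitInterval)
    (hN : ∀ᶠ n in Filter.atTop, n < N n)
    (hlog : ∀ᶠ n : ℕ in Filter.atTop, 4 * Real.log (N n) ≤ n)
    (hω : ∀ᶠ n in Filter.atTop, 2 ≤ ω n)
    (hp : ∀ᶠ n : ℕ in Filter.atTop, (p n : ℝ) = 1 / (ω n * n))
    (hpN : ∀ᶠ n : ℕ in Filter.atTop, 1 / (N n : ℝ) ≤ p n) :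
    Filter.Tendsto
      (fun n : ℕ =>
        SimpleGraph.binomialRandom (Fin (N n)) (p n)
          {G | (G.avoidingColorNumber (SimpleGraph.pathGraph (n + 1)) : ENNReal) ≤
            ENNReal.ofReal (2 * ((N n : ℝ) / n) / ω n)})
      Filter.atTop (nhds 1) := by
  exact corollary5p3_general _ pathGraph_connected (fun _ => Fintype.card_fin _) N ω p
    (hN.mono fun _ => Nat.zero_lt_of_lt)
    (tendsto_mul_three_quarters_pow_of_four_mul_log_le (fun _ => Nat.cast_nonneg _) hlog) hp hpN
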